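/- Let $(\mathcal X,\mathrm{dist})$ be a metric space. For a finite set $S\subseteq\mathcal X$ with at least two points let $\mathrm{div}(S)=\sum_{p\in S}\min_{q\in S\setminus\{p\}}\mathrm{dist}(p,q)$ (the sum of nearest-neighbor distances). Let $m$ be the number of colors, let $k_1,\dots,k_m\ge 0$ be integers, and let $k=\sum_i k_i\ge 2$. For pairwise disjoint finite sets $P_1,\dots,P_m\subseteq\mathcal X$ (the color classes) with $|P_i|\ge k_i$, let $$\mathrm{div}_{k_1,\dots,k_m}(P_1,\dots,P_m)=\max\Big\{\mathrm{div}\Big(\bigcup_i S_i\Big): S_i\subseteq P_i,\ |S_i|=k_i\text{ for all } i\Big\}.$$ For a finite set $Q$, GMM$(Q,t)$ is the greedy algorithm that starts from an arbitrary point of $Q$ and then, $t-1$ times, adds to the current set $G$ a point of $Q$ that maximizes $\mathrm{dist}(\cdot,G)=\min_{x\in G}\mathrm{dist}(\cdot,x)$, ties being broken arbitrarily; it returns the set $G$ (and it returns $\emptyset$ if $Q=\emptyset$). Let $\mathcal A$ be the following algorithm: on a finite set $Q$ and with parameter $k$, start with $S=\emptyset$ and repeat $k$ times: compute $G=$ GMM$(Q,k+1)$,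 replace $S$ by $S\cup G$, and replace $Q$ by $Q\setminus G$. Finally return $S$. Theorem. There is an absolute constant $C>0$ such that, for all $\mathcal X$, $m$, $k_1,\dots,k_m$ as above, $\mathcal A$ with parameter $k$ constructs a $C\,m\log k$-approximate color-abiding composable core-set of size at most $C k^2$ per color. That is, on every finite set $\mathcal A$ has an output, every possible output is a subset of the input and has at most $Ck^2$ points, and for all pairwise disjoint finite $P_1,\dots,P_m\subseteq\mathcal X$ with $|P_i|\ge k_i$ and all possible outputs $T_i$ of $\mathcal A$ on $P_i$ (each computed from $P_i$ and $k$ only), $|T_i|\ge k_i$ for all $i$ and $$\mathrm{div}_{k_1,\dots,k_m}(T_1,\dots,T_m)\ \ge\ \frac{1}{C\,m\log k}\ \mathrm{div}_{k_1,\dots,k_m}(P_1,\dots,P_m).$$ -/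

import Mathlib

open Finset

/-- `GMMRun P t G`: the set `G` is a possible output of the greedy (farthest-point) algorithm GMM
run for `t` steps on the point set `P`.  The first point is arbitrary and ties in the choice of a
farthest point are broken arbitrarily, so this is a relation.  `Metric.infDist q G` is
`min_{x ∈ G} dist q x` (here `G` is finite and nonempty).  If `P` has fewer than `t` points, then
once `P` is exhausted the farthest point is one already chosen and the set does not change; on an
empty point set there is nothing to choose and the output is empty. -/
inductive GMMRun {X : Type*} [MetricSpace X] [DecidableEq X] (P : Finset X) :
    ℕ → Finset X → Prop
  | nothing (t : ℕ) (hP : P = ∅) : GMMRun P t ∅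
  | first (p : X) (hp : p ∈ P) : GMMRun P 1 {p}
  | next (t : ℕ) (G : Finset X) (p : X) (hG : GMMRun P t G) (hp : p ∈ P)
      (hmax : ∀ q ∈ P, Metric.infDist q (G : Set X) ≤ Metric.infDist p (G : Set X)) :
      GMMRun P (t + 1) (insert p G)

/-- `RepeatedGMM k P j S Q`: after `j` rounds of the core-set algorithm on `P` with parameter `k`,
the points collected so far can be `S`, the points still available being `Q`.  Each round runs GMM
for `k + 1` steps on the available points, stores its output and removes it. -/
inductive RepeatedGMM {X : Type*} [MetricSpace X] [DecidableEq X] (k : ℕ) (P : Finset X) :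
    ℕ → Finset X → Finset X → Prop
  | start : RepeatedGMM k P 0 ∅ P
  | round (j : ℕ) (S Q G : Finset X) (h : RepeatedGMM k P j S Q) (hG : GMMRun Q (k + 1) G) :
      RepeatedGMM k P (j + 1) (S ∪ G) (Q \ G)

/-- `T` is a possible output of the Sum-NN core-set algorithm on the point set `P` with
parameter `k`: it collects the points found in `k` rounds. -/
def SumNNCoresetAlg {X : Type*} [MetricSpace X] [DecidableEq X] (k : ℕ) (P T : Finset X) : Prop :=
  ∃ Q, RepeatedGMM k P k T Q

/-- Sum of nearest-neighbor distances, `∑_{p ∈ S} min_{q ∈ S \ {p}} dist p q`. -/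
noncomputable def sumNN {X : Type*} [MetricSpace X] [DecidableEq X] (S : Finset X) : ℝ :=
  ∑ p ∈ S, Metric.infDist p (S.erase p : Set X)

/-- `S` picks exactly `κ i` points of each color `i` from the colored point set `P`. -/
def IsFairSelection {X : Type*} {m : ℕ} (κ : Fin m → ℕ) (P S : Fin m → Finset X) : Prop :=
  ∀ i, S i ⊆ P i ∧ #(S i) = κ i

/-- The optimal value of fair diversity maximization under Sum-NN (a maximum as soon as a
fair selection exists, see `isGreatest_fairDiv`). -/
noncomputable def fairDiv {X : Type*} [MetricSpace X] [DecidableEq X] {m : ℕ}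
    (κ : Fin m → ℕ) (P : Fin m → Finset X) : ℝ :=
  sSup {v : ℝ | ∃ S : Fin m → Finset X, IsFairSelection κ P S ∧ v = sumNN (univ.biUnion S)}

theorem isGreatest_fairDiv {X : Type*} [MetricSpace X] [DecidableEq X] {m : ℕ}
    (κ : Fin m → ℕ) (P : Fin m → Finset X) (hP : ∀ i, κ i ≤ #(P i)) :
    IsGreatest {v : ℝ | ∃ S : Fin m → Finset X,
      IsFairSelection κ P S ∧ v = sumNN (univ.biUnion S)} (fairDiv κ P) := by
  have hfin : {v : ℝ | ∃ S : Fin m → Finset X,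
      IsFairSelection κ P S ∧ v = sumNN (univ.biUnion S)}.Finite := by
    refine ((Fintype.piFinset fun i => (P i).powerset).finite_toSet.image
      (fun S => sumNN (univ.biUnion S))).subset ?_
    rintro v ⟨S, hS, rfl⟩
    refine ⟨S, ?_, rfl⟩
    simp only [Finset.mem_coe, Fintype.mem_piFinset, Finset.mem_powerset]
    exact fun i => (hS i).1
  have hne : {v : ℝ | ∃ S : Fin m → Finset X,
      IsFairSelection κ P S ∧ v = sumNN (univ.biUnion S)}.Nonempty := by
    choose S hS using fun i => Finset.exists_subset_card_eq (hP i)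
    exact ⟨_, S, hS, rfl⟩
  exact ⟨hne.csSup_mem hfin, fun v hv => le_csSup hfin.bddAbove hv⟩

/-- The (possibly nondeterministic) summarization algorithm `A`, where `A Q T` says that `T` is a
possible output on the input `Q`, constructs an `α`-approximate color-abiding composable core-set
for the demands `κ`: it always has an output, which is a subset of the input, and whenever it is
run on each color class separately, whatever its outputs `T i` are, their union still has a fair
selection and its optimal fair diversity is at least `1 / α` times that of the whole data. -/
structure IsColorAbidingComposableCoreset {X : Type*} [MetricSpace X] [DecidableEq X] {m : ℕ}
    (A : Finset X → Finset X → Prop) (κ : Fin m → ℕ) (α : ℝ) : Prop where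
  exists_output : ∀ Q, ∃ T, A Q T
  output_subset : ∀ Q T, A Q T → T ⊆ Q
  approx : ∀ P : Fin m → Finset X, Pairwise (fun i j => Disjoint (P i) (P j)) →
    (∀ i, κ i ≤ #(P i)) → ∀ T : Fin m → Finset X, (∀ i, A (P i) (T i)) →
      (∀ i, κ i ≤ #(T i)) ∧ 1 / α * fairDiv κ P ≤ fairDiv κ T

/-!
Fix a scale `ε`. Each round of the algorithm either finds more than `k` points at pairwise distance
greater than `2 * ε`, or covers all remaining points at scale `2 * ε`. Hence, for each color,
either the core-set contains a large `2 * ε`-packing, or every discarded point has `k` core-set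
points within `2 * ε` of it. In the second case Hall's theorem moves the optimal points of that
color injectively by at most `2 * ε`; in the first case they are replaced one at a time by packing
points at distance more than `ε` from everything else, since each of the fewer than `k` other
points is `ε`-close to at most one packing point. An optimal point whose nearest neighbor is at
distance at least `5 * ε` thus keeps nearest-neighbor distance at least `ε`. So, for every `r`, the
number of optimal points with nearest-neighbor distance at least `r` is at most `5 / r` times the
optimum over the core-sets, and summing over the ranks of these points costs a harmonic number
`O(log k)`.
-/

section MetricLemmas

theorem packingNumber_mono_set {X : Type*} [PseudoEMetricSpace X] {δ : NNReal} {A B : Set X}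
    (hAB : A ⊆ B) : Metric.packingNumber δ A ≤ Metric.packingNumber δ B :=
  iSup_mono fun _ => iSup_mono' fun hCA => ⟨hCA.trans hAB, le_rfl⟩

variable {X : Type*} [PseudoMetricSpace X]

theorem isCover_of_forall_infDist_le {δ : NNReal} {P : Set X} {G : Finset X} (hG : G.Nonempty)
    (h : ∀ q ∈ P, Metric.infDist q (G : Set X) ≤ δ) : Metric.IsCover δ P (G : Set X) := by
  refine Metric.IsCover.of_subset_iUnion_closedBall fun q hq => ?_
  obtain ⟨g, hg, hqg⟩ := G.finite_toSet.isCompact.exists_infDist_eq_dist hG q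
  exact Set.mem_biUnion hg (Metric.mem_closedBall.2 (hqg.symm.trans_le (h q hq)))

/-- Otherwise `A` would be a cover of `T` with fewer members than a packing at twice the scale. -/
theorem exists_mem_forall_lt_dist_of_card_lt_packingNumber {ε : NNReal} {T : Set X} {A : Finset X}
    (h : (#A : ℕ∞) < Metric.packingNumber (2 * ε) T) : ∃ x ∈ T, ∀ a ∈ A, ε < dist x a := by
  by_contra! hclose
  have hcover : Metric.IsCover ε T (A : Set X) :=
    Metric.IsCover.of_subset_iUnion_closedBall fun x hx => by simpa using hclose x hx
  refine h.not_ge ?_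
  calc Metric.packingNumber (2 * ε) T ≤ Metric.externalCoveringNumber ε T :=
        Metric.packingNumber_two_mul_le_externalCoveringNumber ε T
    _ ≤ (A : Set X).encard := hcover.externalCoveringNumber_le_encard
    _ = #A := Set.encard_coe_eq_coe_finsetCard A

theorem exists_extension_forall_lt_dist {ι : Type*} {ε : NNReal} {O D : Finset ι} (hD : D ⊆ O)
    {T : ι → Set X} (h : ∀ p ∈ D, (#O : ℕ∞) ≤ Metric.packingNumber (2 * ε) (T p)) (f₀ : ι → X) :
    ∃ f : ι → X, (∀ p ∉ D, f p = f₀ p) ∧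
      ∀ p ∈ D, f p ∈ T p ∧ ∀ q ∈ O, q ≠ p → ε < dist (f p) (f q) := by
  classical
  induction D using Finset.induction_on with
  | empty => exact ⟨f₀, by simp⟩
  | insert a D ha ih =>
    obtain ⟨haO, hDO⟩ := insert_subset_iff.1 hD
    obtain ⟨f, hf₀, hf⟩ := ih hDO fun p hp => h p (mem_insert_of_mem hp)
    have hcard : (#((O.erase a).image f) : ℕ∞) < Metric.packingNumber (2 * ε) (T a) :=
      (Nat.cast_lt.2 (card_image_le.trans_lt (card_erase_lt_of_mem haO))).trans_le
        (h a (mem_insert_self a D))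
    obtain ⟨x, hxT, hx⟩ := exists_mem_forall_lt_dist_of_card_lt_packingNumber hcard
    have hxf : ∀ q ∈ O, q ≠ a → ε < dist x (f q) := fun q hq hqa =>
      hx (f q) (mem_image_of_mem f (mem_erase.2 ⟨hqa, hq⟩))
    refine ⟨Function.update f a x, fun p hp => ?_, fun p hp => ?_⟩
    · rw [mem_insert, not_or] at hp
      rw [Function.update_of_ne hp.1, hf₀ p hp.2]
    rcases eq_or_ne p a with rfl | hpa
    · refine ⟨by rwa [Function.update_self], fun q hq hqp => ?_⟩
      rw [Function.update_self, Function.update_of_ne hqp]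
      exact hxf q hq hqp
    · obtain ⟨hpT, hfar⟩ := hf p (mem_of_mem_insert_of_ne hp hpa)
      refine ⟨by rwa [Function.update_of_ne hpa], fun q hq hqp => ?_⟩
      rw [Function.update_of_ne hpa]
      rcases eq_or_ne q a with rfl | hqa
      · rw [Function.update_self, dist_comm]
        exact hxf p (hDO (mem_of_mem_insert_of_ne hp hpa)) hpa
      · rw [Function.update_of_ne hqa]
        exact hfar q hq hqp

end MetricLemmas

section CombinatorialLemmas

theorem exists_injOn_mem_of_forall_mem_or_card_le {α : Type*} {O : Finset α} {N : α → Finset α}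
    (h : ∀ p ∈ O, p ∈ N p ∨ #O ≤ #(N p)) :
    ∃ f : α → α, Set.InjOn f O ∧ ∀ p ∈ O, f p ∈ N p := by
  classical
  have hall : ∀ s : Finset O, #s ≤ #(s.biUnion fun p => N p) := by
    intro s
    by_cases hself : ∀ p ∈ s, (p : α) ∈ N p
    · rw [← card_map (Function.Embedding.subtype _)]
      refine card_le_card fun x hx => ?_
      obtain ⟨p, hp, rfl⟩ := mem_map.1 hx
      exact mem_biUnion.2 ⟨p, hp, hself p hp⟩
    · push Not at hself
      obtain ⟨p, hp, hpN⟩ := hself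
      calc #s ≤ Fintype.card O := card_le_univ s
        _ = #O := Fintype.card_coe O
        _ ≤ #(N p) := (h p p.2).resolve_left hpN
        _ ≤ #(s.biUnion fun p => N p) := card_le_card (subset_biUnion_of_mem (fun p : O => N p) hp)
  obtain ⟨g, hg, hgN⟩ := (all_card_le_biUnion_card_iff_exists_injective _).1 hall
  have hext : ∀ p : O, Function.extend (↑) g id (p : α) = g p :=
    Subtype.val_injective.extend_apply g id
  refine ⟨Function.extend (↑) g id, Set.injOn_iff_injective.2 fun p q hpq => hg ?_,
    fun p hp => ?_⟩
  · simpa only [Set.domRestrict_apply, hext] using hpq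
  · exact (hext ⟨p, hp⟩).symm ▸ hgN ⟨p, hp⟩

/-- The value of rank `n` from the top is at most `M / n`, by `h` with `r` equal to that value. -/
theorem sum_le_mul_harmonic_of_card_mul_le {ι : Type*} {s : Finset ι} {f : ι → ℝ} {M : ℝ}
    (h : ∀ r > 0, (#{x ∈ s | r ≤ f x} : ℝ) * r ≤ M) :
    ∑ x ∈ s, f x ≤ M * (harmonic #s : ℝ) := by
  classical
  have hM : 0 ≤ M := le_trans (by positivity) (h 1 one_pos)
  induction hn : #s generalizing s with
  | zero => simp [card_eq_zero.1 hn]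
  | succ n ih =>
    obtain ⟨x, hx, hmin⟩ := s.exists_min_image f (card_pos.1 (by omega))
    have hfx : f x ≤ M * ((n : ℝ) + 1)⁻¹ := by
      rcases le_or_gt (f x) 0 with hneg | hpos
      · exact hneg.trans (by positivity)
      · have hcard := h (f x) hpos
        rw [filter_true_of_mem hmin, hn] at hcard
        rw [← div_eq_mul_inv, le_div_iff₀ (by positivity), mul_comm]
        exact_mod_cast hcard
    have hrest : ∑ y ∈ s.erase x, f y ≤ M * (harmonic n : ℝ) := by
      refine ih (fun r hr => le_trans ?_ (h r hr)) (by rw [card_erase_of_mem hx, hn]; rfl)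
      gcongr
      exact erase_subset x s
    calc ∑ y ∈ s, f y = f x + ∑ y ∈ s.erase x, f y := (add_sum_erase s f hx).symm
      _ ≤ M * ((n : ℝ) + 1)⁻¹ + M * (harmonic n : ℝ) := add_le_add hfx hrest
      _ = M * (harmonic (n + 1) : ℝ) := by rw [harmonic_succ]; push_cast; ring

theorem harmonic_mono : Monotone harmonic :=
  monotone_nat_of_le_succ fun n => by
    rw [harmonic_succ]
    exact le_add_of_nonneg_right (by positivity)

theorem harmonic_le_three_mul_log {k : ℕ} (hk : 2 ≤ k) : (harmonic k : ℝ) ≤ 3 * Real.log k := by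
  have hlog : Real.log 2 ≤ Real.log k := Real.log_le_log two_pos (by exact_mod_cast hk)
  linarith [harmonic_le_one_add_log k, Real.log_two_gt_d9]

end CombinatorialLemmas

section Relocation

variable {X : Type*} [PseudoMetricSpace X]

/-- `HasSubstitutes n δ T p`: among up to `n` points, `p` can be replaced by a point of `T` which is
either within distance `δ` of `p` (the first two cases) or remote from the other chosen points (the
last case). This is the only property of a core-set `T` on which its quality depends. -/
def HasSubstitutes (n : ℕ) (δ : NNReal) (T : Finset X) (p : X) : Prop :=
  p ∈ T ∨ n ≤ #{s ∈ T | dist p s ≤ δ} ∨ (n : ℕ∞) ≤ Metric.packingNumber δ (T : Set X)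

theorem HasSubstitutes.mono {n n' : ℕ} {δ : NNReal} {T : Finset X} {p : X}
    (h : HasSubstitutes n δ T p) (hn : n' ≤ n) : HasSubstitutes n' δ T p :=
  h.imp_right <| Or.imp hn.trans (Nat.cast_le.2 hn).trans

theorem exists_injOn_dist_le_or_lt_dist {ε : NNReal} {O : Finset X} {T : X → Finset X}
    (h : ∀ p ∈ O, HasSubstitutes #O (2 * ε) (T p) p) :
    ∃ f : X → X, Set.InjOn f O ∧ ∀ p ∈ O, f p ∈ T p ∧
      (dist p (f p) ≤ 2 * ε ∨ ∀ q ∈ O, q ≠ p → ε < dist (f p) (f q)) := by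
  classical
  let packed : Finset X := {p ∈ O | (#O : ℕ∞) ≤ Metric.packingNumber (2 * ε) (T p : Set X)}
  obtain ⟨f₀, hf₀_inj, hf₀⟩ : ∃ f₀ : X → X, Set.InjOn f₀ ↑(O \ packed) ∧
      ∀ p ∈ O \ packed, f₀ p ∈ ({s ∈ T p | dist p s ≤ 2 * ε} : Finset X) := by
    refine exists_injOn_mem_of_forall_mem_or_card_le fun p hp => ?_
    obtain ⟨hpO, hp_packed⟩ := mem_sdiff.1 hp
    rcases h p hpO with hpT | hnear | hpack
    · exact .inl (mem_filter.2 ⟨hpT, by simp⟩)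
    · exact .inr ((card_le_card sdiff_subset).trans (by exact_mod_cast hnear))
    · exact absurd (mem_filter.2 ⟨hpO, hpack⟩) hp_packed
  obtain ⟨f, hf_eq, hf_packed⟩ := exists_extension_forall_lt_dist (filter_subset _ O)
    (fun p hp => (mem_filter.1 hp).2) f₀
  refine ⟨f, fun p hp q hq hpq => ?_, fun p hp => ?_⟩
  · by_contra hne
    by_cases hp_packed : p ∈ packed
    · have hfar := (hf_packed p hp_packed).2 q hq (Ne.symm hne)
      rw [hpq, dist_self] at hfar
      exact hfar.not_ge ε.2
    by_cases hq_packed : q ∈ packed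
    · have hfar := (hf_packed q hq_packed).2 p hp hne
      rw [hpq, dist_self] at hfar
      exact hfar.not_ge ε.2
    rw [hf_eq p hp_packed, hf_eq q hq_packed] at hpq
    exact hne (hf₀_inj (mem_sdiff.2 ⟨hp, hp_packed⟩) (mem_sdiff.2 ⟨hq, hq_packed⟩) hpq)
  · by_cases hp_packed : p ∈ packed
    · exact (hf_packed p hp_packed).imp_right .inr
    · rw [hf_eq p hp_packed]
      exact (mem_filter.1 (hf₀ p (mem_sdiff.2 ⟨hp, hp_packed⟩))).imp_right .inl

/-- The points of `S` with nearest-neighbor distance at least `r`. If `S` is a singleton, the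
junk value `Metric.infDist p ∅ = 0` makes this set empty for every `r > 0`. -/
noncomputable def isolatedPoints [DecidableEq X] (r : ℝ) (S : Finset X) : Finset X :=
  {p ∈ S | r ≤ Metric.infDist p (S.erase p : Set X)}

theorem mem_isolatedPoints [DecidableEq X] {r : ℝ} (hr : 0 < r) {S : Finset X} {p : X} :
    p ∈ isolatedPoints r S ↔ p ∈ S ∧ (S.erase p).Nonempty ∧ ∀ q ∈ S, q ≠ p → r ≤ dist p q := by
  rw [isolatedPoints, mem_filter, and_congr_right_iff]
  intro _
  rcases (S.erase p).eq_empty_or_nonempty with hempty | hne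
  · simp [hempty, hr]
  · rw [Metric.le_infDist (coe_nonempty.2 hne)]
    exact ⟨fun h => ⟨hne, fun q hq hqp => h (mem_coe.2 (mem_erase.2 ⟨hqp, hq⟩))⟩,
      fun h q hq => h.2 q (mem_of_mem_erase hq) (ne_of_mem_erase hq)⟩

theorem card_isolatedPoints_le_card_isolatedPoints_image [DecidableEq X] {ε : ℝ} (hε : 0 < ε)
    {O : Finset X} {f : X → X} (hf : Set.InjOn f O)
    (h : ∀ p ∈ O, dist p (f p) ≤ 2 * ε ∨ ∀ q ∈ O, q ≠ p → ε ≤ dist (f p) (f q)) :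
    #(isolatedPoints (5 * ε) O) ≤ #(isolatedPoints ε (O.image f)) := by
  have h5ε : 0 < 5 * ε := by positivity
  refine card_le_card_of_injOn f (fun p hp => ?_) (hf.mono (filter_subset _ O))
  obtain ⟨hpO, ⟨q₀, hq₀⟩, hp_isolated⟩ := (mem_isolatedPoints h5ε).1 hp
  obtain ⟨hq₀p, hq₀O⟩ := mem_erase.1 hq₀
  refine (mem_isolatedPoints hε).2 ⟨mem_image_of_mem f hpO,
    ⟨f q₀, mem_erase.2 ⟨hf.ne hq₀O hpO hq₀p, mem_image_of_mem f hq₀O⟩⟩, ?_⟩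
  refine forall_mem_image.2 fun q hqO hfqp => ?_
  have hqp : q ≠ p := ne_of_apply_ne f hfqp
  rcases h p hpO with hp_near | hp_far
  · rcases h q hqO with hq_near | hq_far
    · have hpq := hp_isolated q hqO hqp
      have htriangle := dist_triangle4_right p q (f p) (f q)
      linarith
    · exact dist_comm (f q) (f p) ▸ hq_far p hpO hqp.symm
  · exact hp_far q hqO hqp

end Relocation

section Algorithm

variable {X : Type*} [MetricSpace X] [DecidableEq X] {P G T S Q : Finset X} {j k t : ℕ}

theorem GMMRun.subset (h : GMMRun P t G) : G ⊆ P := by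
  induction h with
  | nothing => exact empty_subset _
  | first _ hp => exact singleton_subset_iff.2 hp
  | next _ _ _ _ hp _ ih => exact insert_subset hp ih

theorem GMMRun.card_le (h : GMMRun P t G) : #G ≤ t := by
  induction h with
  | nothing => simp
  | first => simp
  | next _ _ _ _ _ _ ih => exact (card_insert_le _ _).trans (by omega)

theorem GMMRun.nonempty (h : GMMRun P t G) (hP : P.Nonempty) : G.Nonempty := by
  cases h with
  | nothing _ hempty => exact absurd hempty hP.ne_empty
  | first => exact singleton_nonempty _
  | next => exact insert_nonempty _ _

theorem exists_gmmRun (P : Finset X) (t : ℕ) : ∃ G, GMMRun P (t + 1) G := by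
  rcases P.eq_empty_or_nonempty with rfl | hP
  · exact ⟨∅, .nothing _ rfl⟩
  induction t with
  | zero =>
    obtain ⟨p, hp⟩ := hP
    exact ⟨{p}, .first p hp⟩
  | succ t ih =>
    obtain ⟨G, hG⟩ := ih
    obtain ⟨p, hp, hmax⟩ := P.exists_max_image (fun q => Metric.infDist q (G : Set X)) hP
    exact ⟨insert p G, .next _ G p hG hp hmax⟩

theorem GMMRun.isCover_or_isSeparated (h : GMMRun P t G) (δ : NNReal) :
    Metric.IsCover δ (P : Set X) (G : Set X) ∨ #G = t ∧ Metric.IsSeparated δ (G : Set X) := by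
  induction h with
  | nothing _ hP => simp [hP]
  | first => simp
  | next t G p hG hp hmax ih =>
    by_cases hcov : Metric.IsCover δ (P : Set X) (G : Set X)
    · exact .inl (hcov.mono (by simp))
    obtain ⟨hcard, hsep⟩ := ih.resolve_left hcov
    have hpG : δ < Metric.infDist p (G : Set X) := by
      by_contra! hle
      exact hcov (isCover_of_forall_infDist_le (hG.nonempty ⟨p, hp⟩)
        fun q hq => (hmax q hq).trans hle)
    have hfar : ∀ y ∈ G, δ < edist p y := fun y hy => by
      rw [edist_nndist]
      exact_mod_cast hpG.trans_le (Metric.infDist_le_dist_of_mem hy)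
    have hnotMem : p ∉ G := fun hmem => by simpa using hfar p hmem
    refine .inr ⟨by rw [card_insert_of_notMem hnotMem, hcard], ?_⟩
    rw [coe_insert]
    exact hsep.insert fun y hy _ => hfar y hy

theorem exists_repeatedGMM (k : ℕ) (P : Finset X) (j : ℕ) : ∃ S Q, RepeatedGMM k P j S Q := by
  induction j with
  | zero => exact ⟨∅, P, .start⟩
  | succ j ih =>
    obtain ⟨S, Q, h⟩ := ih
    obtain ⟨G, hG⟩ := exists_gmmRun Q k
    exact ⟨S ∪ G, Q \ G, .round j S Q G h hG⟩

theorem RepeatedGMM.union_eq (h : RepeatedGMM k P j S Q) : S ∪ Q = P := by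
  induction h with
  | start => exact empty_union P
  | round _ _ _ _ _ hG ih => rw [union_assoc, union_sdiff_of_subset hG.subset, ih]

theorem RepeatedGMM.disjoint (h : RepeatedGMM k P j S Q) : Disjoint S Q := by
  induction h with
  | start => exact disjoint_empty_left P
  | round _ _ _ _ _ _ ih =>
    exact disjoint_union_left.2 ⟨ih.mono_right sdiff_subset, disjoint_sdiff⟩

theorem RepeatedGMM.card_le (h : RepeatedGMM k P j S Q) : #S ≤ j * (k + 1) := by
  induction h with
  | start => simp
  | round j S _ G _ hG ih =>
    calc #(S ∪ G) ≤ #S + #G := card_union_le S G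
      _ ≤ j * (k + 1) + (k + 1) := add_le_add ih hG.card_le
      _ = (j + 1) * (k + 1) := by ring

theorem RepeatedGMM.lt_packingNumber_or_le_card (h : RepeatedGMM k P j S Q) (δ : NNReal) :
    (k : ℕ∞) < Metric.packingNumber δ (S : Set X) ∨ ∀ q ∈ Q, j ≤ #{s ∈ S | dist q s ≤ δ} := by
  induction h with
  | start => simp
  | round j S Q G h hG ih =>
    rcases hG.isCover_or_isSeparated δ with hcov | ⟨hcard, hsep⟩
    · refine ih.imp (fun hS => hS.trans_le (packingNumber_mono_set (by simp)))
        fun hnear q hq => ?_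
      obtain ⟨hqQ, -⟩ := mem_sdiff.1 hq
      obtain ⟨g, hg, hqg⟩ := Set.mem_iUnion₂.1 (hcov.subset_iUnion_closedBall hqQ)
      have hgS : g ∉ S := disjoint_right.1 h.disjoint (hG.subset hg)
      calc j + 1 ≤ #{s ∈ S | dist q s ≤ δ} + 1 := Nat.succ_le_succ (hnear q hqQ)
        _ = #(insert g {s ∈ S | dist q s ≤ δ}) := by
          rw [card_insert_of_notMem fun hmem => hgS (mem_filter.1 hmem).1]
        _ ≤ #{s ∈ S ∪ G | dist q s ≤ δ} := card_le_card <| insert_subset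
          (mem_filter.2 ⟨mem_union_right S hg, hqg⟩) (filter_subset_filter _ subset_union_left)
    · left
      calc (k : ℕ∞) < (G : Set X).encard := by
            rw [Set.encard_coe_eq_coe_finsetCard, hcard]
            exact_mod_cast k.lt_succ_self
        _ ≤ Metric.packingNumber δ (↑(S ∪ G) : Set X) :=
          hsep.encard_le_packingNumber (by simp)

theorem SumNNCoresetAlg.subset (h : SumNNCoresetAlg k P T) : T ⊆ P := by
  obtain ⟨Q, hQ⟩ := h
  exact hQ.union_eq ▸ subset_union_left

theorem SumNNCoresetAlg.card_le (h : SumNNCoresetAlg k P T) : #T ≤ k * (k + 1) := by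
  obtain ⟨Q, hQ⟩ := h
  exact hQ.card_le

theorem SumNNCoresetAlg.hasSubstitutes (h : SumNNCoresetAlg k P T) (δ : NNReal) {p : X}
    (hp : p ∈ P) : HasSubstitutes k δ T p := by
  obtain ⟨Q, hQ⟩ := h
  rw [← hQ.union_eq, mem_union] at hp
  refine hp.imp_right fun hpQ => ?_
  exact (hQ.lt_packingNumber_or_le_card δ).symm.imp (fun hnear => hnear p hpQ) le_of_lt

theorem SumNNCoresetAlg.min_card_le (h : SumNNCoresetAlg k P T) : min k #P ≤ #T := by
  by_cases hPT : P ⊆ T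
  · exact (min_le_right k #P).trans (card_le_card hPT)
  obtain ⟨p, hp, hpT⟩ := not_subset.1 hPT
  refine (min_le_left k #P).trans ?_
  rcases (h.hasSubstitutes 0 hp).resolve_left hpT with hnear | hpack
  · exact hnear.trans (card_filter_le T _)
  · have hle := hpack.trans (Metric.packingNumber_le_encard_self (T : Set X))
    rw [Set.encard_coe_eq_coe_finsetCard] at hle
    exact_mod_cast hle

end Algorithm

section Diversity

theorem IsFairSelection.card_biUnion_le {X : Type*} [DecidableEq X] {m : ℕ} {κ : Fin m → ℕ}
    {P S : Fin m → Finset X} (hS : IsFairSelection κ P S) : #(univ.biUnion S) ≤ ∑ i, κ i :=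
  Finset.card_biUnion_le.trans_eq (sum_congr rfl fun i _ => (hS i).2)

variable {X : Type*} [MetricSpace X] [DecidableEq X] {m k : ℕ} {κ : Fin m → ℕ}
  {P T O S : Fin m → Finset X}

theorem sumNN_nonneg (S : Finset X) : 0 ≤ sumNN S :=
  sum_nonneg fun _ _ => Metric.infDist_nonneg

theorem card_isolatedPoints_mul_le_sumNN (r : ℝ) (S : Finset X) :
    #(isolatedPoints r S) * r ≤ sumNN S := by
  rw [← nsmul_eq_mul]
  exact (card_nsmul_le_sum _ _ r fun p hp => (mem_filter.1 hp).2).trans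
    (sum_le_sum_of_subset_of_nonneg (filter_subset _ S) fun _ _ _ => Metric.infDist_nonneg)

theorem sumNN_le_mul_harmonic {S : Finset X} {M : ℝ}
    (h : ∀ r > 0, #(isolatedPoints r S) * r ≤ M) : sumNN S ≤ M * (harmonic #S : ℝ) :=
  sum_le_mul_harmonic_of_card_mul_le h

theorem fairDiv_nonneg (κ : Fin m → ℕ) (P : Fin m → Finset X) : 0 ≤ fairDiv κ P := by
  refine Real.sSup_nonneg ?_
  rintro _ ⟨S, -, rfl⟩
  exact sumNN_nonneg _

theorem IsFairSelection.sumNN_le_fairDiv (hS : IsFairSelection κ P S) :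
    sumNN (univ.biUnion S) ≤ fairDiv κ P :=
  (isGreatest_fairDiv κ P fun i => (hS i).2 ▸ card_le_card (hS i).1).2 ⟨S, hS, rfl⟩

theorem exists_isFairSelection_card_isolatedPoints_le
    (hP : Pairwise fun i j => Disjoint (P i) (P j)) (hO : IsFairSelection κ P O) {ε : NNReal}
    (hε : 0 < ε) (hT : ∀ i, ∀ p ∈ P i, HasSubstitutes (∑ i, κ i) (2 * ε) (T i) p) :
    ∃ S, IsFairSelection κ T S ∧
      #(isolatedPoints (5 * ε) (univ.biUnion O)) ≤ #(isolatedPoints ε (univ.biUnion S)) := by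
  have htarget : ∀ p ∈ univ.biUnion O, ∃ A : Finset X, ∀ i, p ∈ P i → A = T i := by
    intro p hp
    obtain ⟨i, -, hpi⟩ := mem_biUnion.1 hp
    refine ⟨T i, fun j hpj => congrArg T ?_⟩
    by_contra hij
    exact disjoint_left.1 (hP hij) ((hO i).1 hpi) hpj
  choose! target htarget using htarget
  obtain ⟨f, hf_inj, hf⟩ : ∃ f : X → X, Set.InjOn f (univ.biUnion O) ∧ ∀ p ∈ univ.biUnion O,
      f p ∈ target p ∧ (dist p (f p) ≤ 2 * ε ∨
        ∀ q ∈ univ.biUnion O, q ≠ p → ε < dist (f p) (f q)) := by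
    refine exists_injOn_dist_le_or_lt_dist fun p hp => ?_
    obtain ⟨i, -, hpi⟩ := mem_biUnion.1 hp
    rw [htarget p hp i ((hO i).1 hpi)]
    exact (hT i p ((hO i).1 hpi)).mono hO.card_biUnion_le
  have hsub : ∀ i, O i ⊆ univ.biUnion O := fun i => subset_biUnion_of_mem O (mem_univ i)
  refine ⟨fun i => (O i).image f, fun i => ⟨image_subset_iff.2 fun p hp => ?_, ?_⟩, ?_⟩
  · exact htarget p (hsub i hp) i ((hO i).1 hp) ▸ (hf p (hsub i hp)).1
  · rw [card_image_of_injOn (hf_inj.mono (hsub i)), (hO i).2]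
  · rw [← biUnion_image]
    exact card_isolatedPoints_le_card_isolatedPoints_image hε hf_inj fun p hp =>
      (hf p hp).2.imp_right fun hfar q hq hqp => (hfar q hq hqp).le

theorem fairDiv_le_mul_log_mul_fairDiv (hκ : ∑ i, κ i ≤ k) (hk : 2 ≤ k)
    (hP : Pairwise fun i j => Disjoint (P i) (P j)) (hκP : ∀ i, κ i ≤ #(P i))
    (hT : ∀ (δ : NNReal) i, ∀ p ∈ P i, HasSubstitutes (∑ i, κ i) δ (T i) p) :
    fairDiv κ P ≤ 15 * Real.log k * fairDiv κ T := by
  obtain ⟨⟨O, hO, hO_opt⟩, -⟩ := isGreatest_fairDiv κ P hκP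
  have hisolated : ∀ r > 0, #(isolatedPoints r (univ.biUnion O)) * r ≤ 5 * fairDiv κ T := by
    intro r hr
    obtain ⟨ε, rfl⟩ : ∃ ε : NNReal, r = 5 * ε :=
      ⟨(r / 5).toNNReal, by rw [Real.coe_toNNReal _ (by positivity)]; ring⟩
    have hε : 0 < ε := by simpa using hr
    obtain ⟨S, hS, hcard⟩ := exists_isFairSelection_card_isolatedPoints_le hP hO hε (hT (2 * ε))
    calc #(isolatedPoints (5 * ε) (univ.biUnion O)) * (5 * ε : ℝ)
        ≤ #(isolatedPoints ε (univ.biUnion S)) * (5 * ε : ℝ) := by gcongr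
      _ = 5 * (#(isolatedPoints ε (univ.biUnion S)) * (ε : ℝ)) := by ring
      _ ≤ 5 * fairDiv κ T := by
        gcongr
        exact (card_isolatedPoints_mul_le_sumNN _ _).trans hS.sumNN_le_fairDiv
  have hharmonic : (harmonic #(univ.biUnion O) : ℝ) ≤ 3 * Real.log k :=
    (Rat.cast_le.2 (harmonic_mono (hO.card_biUnion_le.trans hκ))).trans
      (harmonic_le_three_mul_log hk)
  calc fairDiv κ P = sumNN (univ.biUnion O) := hO_opt
    _ ≤ 5 * fairDiv κ T * (harmonic #(univ.biUnion O) : ℝ) := sumNN_le_mul_harmonic hisolated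
    _ ≤ 5 * fairDiv κ T * (3 * Real.log k) := by
      gcongr
      exact mul_nonneg (by norm_num) (fairDiv_nonneg κ T)
    _ = 15 * Real.log k * fairDiv κ T := by ring

theorem IsColorAbidingComposableCoreset.mono {A : Finset X → Finset X → Prop} {α β : ℝ}
    (h : IsColorAbidingComposableCoreset A κ α) (hα : 0 < α) (hαβ : α ≤ β) :
    IsColorAbidingComposableCoreset A κ β where
  exists_output := h.exists_output
  output_subset := h.output_subset
  approx P hP hκP T hT := by
    obtain ⟨hκT, happrox⟩ := h.approx P hP hκP T hT
    refine ⟨hκT, le_trans ?_ happrox⟩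
    exact mul_le_mul_of_nonneg_right (one_div_le_one_div_of_le hα hαβ) (fairDiv_nonneg κ P)

end Diversity

theorem mainTheorem5_general {X : Type*} [MetricSpace X] [DecidableEq X] {m k : ℕ} {κ : Fin m → ℕ}
    (hκ : ∑ i, κ i ≤ k) (hk : 2 ≤ k) :
    IsColorAbidingComposableCoreset (X := X) (SumNNCoresetAlg k) κ (15 * Real.log k) ∧
      ∀ Q T : Finset X, SumNNCoresetAlg k Q T → #T ≤ k * (k + 1) := by
  refine ⟨⟨fun Q => ?_, fun Q T hT => hT.subset, fun P hP hκP T hT => ⟨fun i => ?_, ?_⟩⟩,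
    fun Q T hT => hT.card_le⟩
  · exact exists_repeatedGMM k Q k
  · have hκk : κ i ≤ k := (single_le_sum (fun _ _ => Nat.zero_le _) (mem_univ i)).trans hκ
    exact (le_min hκk (hκP i)).trans (hT i).min_card_le
  · have hlog : 0 < Real.log k := Real.log_pos (by exact_mod_cast hk)
    rw [one_div_mul_eq_div, div_le_iff₀' (by positivity)]
    exact fairDiv_le_mul_log_mul_fairDiv hκ hk hP hκP
      fun δ i p hp => ((hT i).hasSubstitutes δ hp).mono hκ

theorem mainTheorem5 :
    ∃ C : ℝ, 0 < C ∧
      ∀ (X : Type*) [MetricSpace X] [DecidableEq X] (m : ℕ) (κ : Fin m → ℕ) (k : ℕ),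
        k = ∑ i, κ i → 2 ≤ k →
          IsColorAbidingComposableCoreset (X := X) (SumNNCoresetAlg k) κ
              (C * (m * Real.log k)) ∧
            ∀ Q T : Finset X, SumNNCoresetAlg k Q T → (#T : ℝ) ≤ C * (k : ℝ) ^ 2 := by
  refine ⟨15, by norm_num, fun X _ _ m κ k hk hk2 => ?_⟩
  obtain ⟨hcoreset, hcard⟩ := mainTheorem5_general (X := X) hk.ge hk2
  have hlog : 0 < Real.log k := Real.log_pos (by exact_mod_cast hk2)
  have hm : m ≠ 0 := by
    rintro rfl
    simp at hk
    omega
  refine ⟨hcoreset.mono (by positivity) ?_, fun Q T hT => ?_⟩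
  · gcongr
    exact le_mul_of_one_le_left hlog.le (Nat.one_le_cast.2 (Nat.one_le_iff_ne_zero.2 hm))
  · exact_mod_cast (hcard Q T hT).trans (by nlinarith : k * (k + 1) ≤ 15 * k ^ 2)
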